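/- Let $k$ be a field and let $B$ be an affine $k$-domain, i.e. an integral domain that is a finitely generated commutative $k$-algebra. For a field extension $K/k$, write $K/k \in \mathrm{PE}_k(B)$ if for some $n \in \mathbb{N}$ (with $0 \in \mathbb{N}$) there exists an injective homomorphism of $K$-algebras from $K \otimes_k B$ to a polynomial ring $K[X_1,\dots,X_n]$ in $n$ variables over $K$. Suppose that $\mathrm{PE}_k(B) \neq \emptyset$, i.e. that $K/k \in \mathrm{PE}_k(B)$ for some field extension $K/k$. Then: (a) there exists a finite field extension $k'$ of $k$ such that $k'/k \in \mathrm{PE}_k(B)$; (b) the algebraic closure $\bar k$ of $k$ satisfies $\bar k/k \in \mathrm{PE}_k(B)$. -/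

import Mathlib

open scoped TensorProduct

universe u v w x

/-- `B ⊆ k^{[n]}`: there is an injective homomorphism of `k`-algebras from `B` to a polynomial
algebra in `n` variables over `k`. -/
def EmbedsInPolynomialRing (k : Type*) [Field k] (B : Type*) [CommRing B] [Algebra k B]
    (n : ℕ) : Prop :=
  ∃ φ : B →ₐ[k] MvPolynomial (Fin n) k, Function.Injective φ

/-- Membership of the field extension `K/k` in the class `PE_k(B)`:
`K ⊗_k B ⊆ K^{[n]}` (as `K`-algebras) for some natural number `n`. -/
def MemPE (k : Type*) [Field k] (B : Type*) [CommRing B] [Algebra k B]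
    (K : Type*) [Field K] [Algebra k K] : Prop :=
  ∃ n : ℕ, EmbedsInPolynomialRing K (K ⊗[k] B) n

section Specialization

open MvPolynomial Algebra

/-! Spread the embedding out over a finitely generated `k`-algebra `R ⊆ K` and specialize at a
maximal ideal `m`; `R ⧸ m` is finite over `k` by Zariski's lemma. Injectivity survives a general
specialization: by Noether normalization `B` is integral over some `k[x]`, the images of the `x i`
are algebraically independent, and that persists wherever a certain nonzero `r : R` does not vanish.
Since `(R ⧸ m) ⊗ B` is a domain integral over `(R ⧸ m)[x]`, injectivity on the latter suffices. Part
(b) follows by base change. -/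

theorem MvPolynomial.map_mem_adjoin {R F σ : Type*} [CommRing R] [CommRing F] (ψ : R →+* F)
    (s : Set (MvPolynomial σ R)) {a : MvPolynomial σ R} (ha : a ∈ adjoin R s) :
    map ψ a ∈ adjoin F (map ψ '' s) := by
  induction ha using adjoin_induction with
  | mem y hy => exact subset_adjoin ⟨y, hy, rfl⟩
  | algebraMap r =>
    rw [MvPolynomial.algebraMap_eq, map_C]
    exact (adjoin F (map ψ '' s)).algebraMap_mem (ψ r)
  | add y z _ _ hy hz => rw [map_add]; exact add_mem hy hz
  | mul y z _ _ hy hz => rw [map_mul]; exact mul_mem hy hz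

/-- An algebraic relation over the subalgebra generated by `s` survives every specialization of
the coefficients outside a hypersurface. -/
theorem MvPolynomial.exists_ne_zero_forall_isAlgebraic_map {R σ : Type*} [CommRing R]
    (s : Set (MvPolynomial σ R)) (a : MvPolynomial σ R) (ha : IsAlgebraic (adjoin R s) a) :
    ∃ r : R, r ≠ 0 ∧ ∀ {F : Type u} [Field F] (ψ : R →+* F), ψ r ≠ 0 →
      IsAlgebraic (adjoin F (map ψ '' s)) (map ψ a) := by
  obtain ⟨p, hp, hpa⟩ := ha
  obtain ⟨i, hi⟩ := Polynomial.support_nonempty.mpr hp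
  have hi' : (p.coeff i : MvPolynomial σ R) ≠ 0 := by
    simpa using Polynomial.mem_support_iff.mp hi
  obtain ⟨m, hm⟩ := MvPolynomial.ne_zero_iff.mp hi'
  -- The witness is one nonzero scalar inside one coefficient of the relation `p`; keeping it
  -- nonzero keeps the specialized relation nontrivial.
  refine ⟨_, hm, fun {F} _ ψ hψ => ?_⟩
  let θ : adjoin R s →+* adjoin F (map ψ '' s) :=
    (map ψ).restrict _ _ fun y hy => map_mem_adjoin ψ s hy
  refine ⟨p.map θ, fun h => hψ ?_, ?_⟩
  · have h1 : θ (p.coeff i) = 0 := by rw [← Polynomial.coeff_map, h, Polynomial.coeff_zero]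
    have h2 : map ψ (p.coeff i : MvPolynomial σ R) = 0 := congrArg Subtype.val h1
    rw [← coeff_map, h2, coeff_zero]
  · have := congrArg (map ψ) hpa
    rw [Polynomial.aeval_def, Polynomial.hom_eval₂, map_zero] at this
    rw [Polynomial.aeval_def, Polynomial.eval₂_map]
    exact this

theorem MvPolynomial.isAlgebraic_of_isAlgebraic_X {F σ : Type*} [CommRing F] [IsDomain F]
    (S : Subalgebra F (MvPolynomial σ F)) (h : ∀ i, IsAlgebraic S (X i : MvPolynomial σ F)) :
    Algebra.IsAlgebraic S (MvPolynomial σ F) := by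
  have htop : (Subalgebra.algebraicClosure S (MvPolynomial σ F)).restrictScalars F = ⊤ := by
    rw [_root_.eq_top_iff, ← MvPolynomial.adjoin_range_X]
    refine adjoin_le ?_
    rintro _ ⟨i, rfl⟩
    exact h i
  refine ⟨fun y => ?_⟩
  have hy : y ∈ (Subalgebra.algebraicClosure S (MvPolynomial σ F)).restrictScalars F := by
    rw [htop]; trivial
  exact hy

/-- The finitely many relations making each `X j` algebraic over the family specialize together. The
specialized family has as many members as there are variables, so algebraicity of the ring over it
forces independence. -/
theorem MvPolynomial.exists_ne_zero_forall_isTranscendenceBasis_map {R : Type*} {σ ι : Type*}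
    [CommRing R] [IsDomain R] [Finite σ] (f : ι → MvPolynomial σ R)
    (hf : IsTranscendenceBasis R f) :
    ∃ r : R, r ≠ 0 ∧ ∀ {F : Type u} [Field F] (ψ : R →+* F), ψ r ≠ 0 →
      IsTranscendenceBasis F (fun i => map ψ (f i)) := by
  have := Fintype.ofFinite σ
  have halg := hf.isAlgebraic
  choose r hr hrψ using fun j : σ => exists_ne_zero_forall_isAlgebraic_map.{u}
    (Set.range f) (X j) (halg.isAlgebraic _)
  refine ⟨∏ j, r j, Finset.prod_ne_zero_iff.mpr fun j _ => hr j, fun {F} _ ψ hψ => ?_⟩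
  rw [map_prod, Finset.prod_ne_zero_iff] at hψ
  have halg' : Algebra.IsAlgebraic (adjoin F (Set.range fun i => map ψ (f i)))
      (MvPolynomial σ F) := by
    refine isAlgebraic_of_isAlgebraic_X _ fun j => ?_
    have := hrψ j ψ (hψ j (Finset.mem_univ j))
    rwa [map_X, ← Set.range_comp] at this
  have hcard := (IsTranscendenceBasis.mvPolynomial σ R).lift_cardinalMk_eq hf
  have : Finite ι := by
    rw [← Cardinal.mk_lt_aleph0_iff, ← Cardinal.lift_lt_aleph0, ← hcard]
    simp
  have hcard' : Nat.card ι = Nat.card σ := by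
    simpa [Nat.card] using (congrArg Cardinal.toNat hcard).symm
  refine Algebra.IsAlgebraic.isTranscendenceBasis_of_lift_le_trdeg_of_finite F _ ?_
  rw [MvPolynomial.trdeg_of_isDomain, ← Nat.cast_card (α := ι), ← Nat.cast_card (α := σ), hcard']
  simp

/-- Algebraic independence of polynomials survives every specialization of the coefficients
outside a hypersurface. -/
theorem MvPolynomial.exists_ne_zero_forall_algebraicIndependent_map {R : Type*} {σ ι : Type*}
    [CommRing R] [IsDomain R] [Finite σ] (f : ι → MvPolynomial σ R)
    (hf : AlgebraicIndependent R f) :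
    ∃ r : R, r ≠ 0 ∧ ∀ {F : Type u} [Field F] (ψ : R →+* F), ψ r ≠ 0 →
      AlgebraicIndependent F (fun i => map ψ (f i)) := by
  -- Independence alone is not witnessed by equations; completing to a transcendence basis turns it
  -- into algebraicity of the variables, which is.
  obtain ⟨t, hft, ht⟩ := exists_isTranscendenceBasis_superset hf.coe_range
  obtain ⟨r, hr, h⟩ := exists_ne_zero_forall_isTranscendenceBasis_map.{u} _ ht
  refine ⟨r, hr, fun {F} _ ψ hψ => ?_⟩
  exact (h ψ hψ).1.comp (fun i => ⟨f i, hft ⟨i, rfl⟩⟩) fun i j hij =>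
    hf.injective (congrArg Subtype.val hij)

end Specialization

section BaseChange

theorem MemPE.mono {k : Type*} [Field k] {B : Type*} [CommRing B] [Algebra k B]
    {K L : Type*} [Field K] [Algebra k K] [Field L] [Algebra k L] (i : K →ₐ[k] L)
    (h : MemPE k B K) : MemPE k B L := by
  obtain ⟨n, φ, hφ⟩ := h
  algebraize [i.toRingHom]
  have : IsScalarTower k K L := .of_algebraMap_eq fun a => (i.commutes a).symm
  refine ⟨n, ((MvPolynomial.algebraTensorAlgEquiv K L).toAlgHom.comp
    (Algebra.TensorProduct.map (AlgHom.id L L) φ)).comp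
    (Algebra.TensorProduct.cancelBaseChange k K L L B).symm.toAlgHom, ?_⟩
  have h1 : Function.Injective (Algebra.TensorProduct.map (AlgHom.id L L) φ) :=
    Module.Flat.lTensor_preserves_injective_linearMap (M := L) φ.toLinearMap hφ
  exact ((MvPolynomial.algebraTensorAlgEquiv K L).injective.comp h1).comp
    (Algebra.TensorProduct.cancelBaseChange k K L L B).symm.injective

/-- Both `F` and `K` map to `AlgebraicClosure K`, so by flatness `F ⊗ B` sits inside a polynomial
ring over that field. -/
theorem MemPE.isDomain_tensorProduct {k : Type*} [Field k] {B : Type*} [CommRing B] [Algebra k B]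
    {K F : Type*} [Field K] [Algebra k K] [Field F] [Algebra k F] [Algebra.IsAlgebraic k F]
    (h : MemPE k B K) : IsDomain (F ⊗[k] B) := by
  obtain ⟨n, φ, hφ⟩ := h.mono (IsScalarTower.toAlgHom k K (AlgebraicClosure K))
  let j : F →ₐ[k] AlgebraicClosure K := IsAlgClosed.lift
  have h1 : Function.Injective (Algebra.TensorProduct.map j (AlgHom.id k B)) :=
    Module.Flat.rTensor_preserves_injective_linearMap (M := B) j.toLinearMap j.injective
  exact (hφ.comp h1).isDomain
    (φ.toRingHom.comp (Algebra.TensorProduct.map j (AlgHom.id k B)).toRingHom)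

theorem AlgHom.IsIntegral.tensorProduct_map_id {k A B C : Type*} [CommRing k] [CommRing A]
    [CommRing B] [CommRing C] [Algebra k A] [Algebra k B] [Algebra k C] (g : A →ₐ[k] B)
    (hg : g.toRingHom.IsIntegral) :
    (Algebra.TensorProduct.map (AlgHom.id C C) g).toRingHom.IsIntegral := by
  intro x
  induction x using TensorProduct.induction_on with
  | zero => exact RingHom.isIntegralElem_zero _
  | add x y hx hy => exact RingHom.IsIntegralElem.add _ hx hy
  | tmul c b =>
    rw [show c ⊗ₜ[k] b = (c ⊗ₜ[k] 1) * (1 ⊗ₜ[k] b) by simp]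
    refine RingHom.IsIntegralElem.mul _ ?_ ?_
    · convert! RingHom.isIntegralElem_map
        (Algebra.TensorProduct.map (AlgHom.id C C) g).toRingHom (x := c ⊗ₜ[k] (1 : A))
      simp
    · obtain ⟨p, hp, hpb⟩ := hg b
      refine ⟨p.map (Algebra.TensorProduct.includeRight : A →ₐ[k] C ⊗[k] A).toRingHom,
        hp.map _, ?_⟩
      have := congrArg (Algebra.TensorProduct.includeRight : B →ₐ[k] C ⊗[k] B) hpb
      rw [map_zero] at this
      rw [Polynomial.eval₂_map, ← this]
      change _ = (Algebra.TensorProduct.includeRight : B →ₐ[k] C ⊗[k] B).toRingHom _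
      rw [Polynomial.hom_eval₂]
      congr 1

/-- In a domain integral over `A`, a nonzero ideal has nonzero contraction to `A`; apply this to the
kernel of `Φ`. -/
theorem RingHom.IsIntegral.injective_of_injective_comp {A C D : Type*} [CommRing A] [CommRing C]
    [IsDomain C] [CommRing D] {G : A →+* C} (hG : G.IsIntegral) (Φ : C →+* D)
    (h : Function.Injective (Φ.comp G)) : Function.Injective Φ := by
  algebraize [G]
  have : Nontrivial A := G.domain_nontrivial
  rw [RingHom.injective_iff_ker_eq_bot] at h ⊢
  rw [← RingHom.comap_ker] at h
  exact Ideal.eq_bot_of_comap_eq_bot (R := A) h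

theorem algebraicIndependent_iff_injective_lift_comp_map {k K A B σ : Type*} [CommRing k]
    [CommRing K] [CommRing A] [CommRing B] [Algebra k K] [Algebra k B] [Algebra k A]
    [Algebra K A] [IsScalarTower k K A] (g : MvPolynomial σ k →ₐ[k] B) (θ : B →ₐ[k] A) :
    AlgebraicIndependent K (fun i => θ (g (MvPolynomial.X i))) ↔
      Function.Injective ((Algebra.TensorProduct.lift (Algebra.ofId K A) θ
        fun _ _ => Commute.all _ _).comp (Algebra.TensorProduct.map (AlgHom.id K K) g)) := by
  have key : (Algebra.TensorProduct.lift (Algebra.ofId K A) θ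
        fun _ _ => Commute.all _ _).comp (Algebra.TensorProduct.map (AlgHom.id K K) g) =
      (MvPolynomial.aeval fun i => θ (g (MvPolynomial.X i))).comp
        (MvPolynomial.algebraTensorAlgEquiv k K).toAlgHom := by
    ext i
    simp
  rw [key, AlgHom.coe_comp]
  exact (EquivLike.injective_comp (MvPolynomial.algebraTensorAlgEquiv k K) _).symm

/-- `R` is generated by the finitely many coefficients of the images of generators of `B`. -/
theorem exists_fg_subalgebra_mapAlgHom_comp_eq {k K B σ : Type*} [CommRing k] [CommRing K]
    [CommRing B] [Algebra k K] [Algebra k B] [Algebra.FiniteType k B]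
    (θ : B →ₐ[k] MvPolynomial σ K) :
    ∃ R : Subalgebra k K, R.FG ∧ ∃ θ' : B →ₐ[k] MvPolynomial σ R,
      (MvPolynomial.mapAlgHom R.val).comp θ' = θ := by
  classical
  obtain ⟨s, hs⟩ := Algebra.FiniteType.out (R := k) (A := B)
  let R := Algebra.adjoin k ((s.biUnion fun b => (θ b).coeffs : Finset K) : Set K)
  have hinj : Function.Injective (MvPolynomial.mapAlgHom (σ := σ) R.val) :=
    MvPolynomial.map_injective _ Subtype.val_injective
  have hle : θ.range ≤ (MvPolynomial.mapAlgHom (σ := σ) R.val).range := by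
    rw [← Algebra.map_top, ← hs, AlgHom.map_adjoin]
    refine Algebra.adjoin_le ?_
    rintro _ ⟨b, hb, rfl⟩
    obtain ⟨q, hq⟩ := MvPolynomial.mem_range_map_iff_coeffs_subset (f := R.val.toRingHom)
      (x := θ b) |>.mpr fun c hc => ⟨⟨c, Algebra.subset_adjoin (by
        simp only [Finset.coe_biUnion, Set.mem_iUnion]
        exact ⟨b, hb, hc⟩)⟩, rfl⟩
    exact ⟨q, hq⟩
  let e := AlgEquiv.ofInjective _ hinj
  refine ⟨R, ⟨_, rfl⟩, e.symm.toAlgHom.comp (θ.codRestrict _ fun b => hle ⟨b, rfl⟩), ?_⟩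
  ext1 b
  exact congrArg Subtype.val (e.apply_symm_apply (θ.codRestrict _ (fun b => hle ⟨b, rfl⟩) b))

end BaseChange

/-- Generic specialization of an embedding into a polynomial ring. -/
theorem MemPE.exists_finite {k : Type u} [Field k] {B : Type v} [CommRing B] [IsDomain B]
    [Algebra k B] [Algebra.FiniteType k B] {K : Type w} [Field K] [Algebra k K]
    (h : MemPE k B K) :
    ∃ (F : Type w) (_ : Field F) (_ : Algebra k F), Module.Finite k F ∧ MemPE k B F := by
  obtain ⟨n, φ, hφ⟩ := id h
  obtain ⟨s, g, hg, hgint⟩ := exists_integral_inj_algHom_of_fg k B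
  let θ : B →ₐ[k] MvPolynomial (Fin n) K :=
    (φ.restrictScalars k).comp Algebra.TensorProduct.includeRight
  obtain ⟨R, hR, θ', hθ'⟩ := exists_fg_subalgebra_mapAlgHom_comp_eq θ
  have hindK : AlgebraicIndependent K (fun i => θ (g (MvPolynomial.X i))) := by
    rw [algebraicIndependent_iff_injective_lift_comp_map]
    have : Algebra.TensorProduct.lift (Algebra.ofId K _) θ (fun _ _ => Commute.all _ _) = φ := by
      ext b
      simp [θ]
    rw [this, AlgHom.coe_comp]
    exact hφ.comp (Module.Flat.lTensor_preserves_injective_linearMap (M := K) g.toLinearMap hg)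
  have hindR : AlgebraicIndependent R (fun i => θ' (g (MvPolynomial.X i))) := by
    have h1 : AlgebraicIndependent K
        (MvPolynomial.mapAlgHom R.val ∘ fun i => θ' (g (MvPolynomial.X i))) := by
      rw [← hθ'] at hindK
      exact hindK
    refine h1.of_ringHom_of_comp_eq R.val (MvPolynomial.mapAlgHom R.val)
      Subtype.val_injective ?_
    ext a
    simp
  obtain ⟨r, hr, hspec⟩ :=
    MvPolynomial.exists_ne_zero_forall_algebraicIndependent_map.{w} _ hindR
  have : Algebra.FiniteType k R := R.fg_iff_finiteType.mp hR
  have : IsJacobsonRing R := isJacobsonRing_of_finiteType (A := k)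
  -- `R` is a Jacobson domain, so its maximal ideals intersect in zero and one of them misses `r`.
  obtain ⟨m, hm, hrm⟩ : ∃ m : Ideal R, m.IsMaximal ∧ r ∉ m := by
    by_contra! hcon
    apply hr
    have : r ∈ Ideal.jacobson (⊥ : Ideal R) :=
      Ideal.mem_sInf.mpr fun {I} hI => hcon I hI.2
    rwa [IsJacobsonRing.out ‹_› Ideal.isRadical_bot] at this
  let _ : Field (R ⧸ m) := Ideal.Quotient.field m
  have hfin : Module.Finite k (R ⧸ m) := finite_of_finite_type_of_isJacobsonRing k (R ⧸ m)
  have hind := hspec (Ideal.Quotient.mk m) (by rwa [Ne, Ideal.Quotient.eq_zero_iff_mem])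
  let θm : B →ₐ[k] MvPolynomial (Fin n) (R ⧸ m) :=
    (MvPolynomial.mapAlgHom (Ideal.Quotient.mkₐ k m)).comp θ'
  let Φ : (R ⧸ m) ⊗[k] B →ₐ[R ⧸ m] MvPolynomial (Fin n) (R ⧸ m) :=
    Algebra.TensorProduct.lift (Algebra.ofId (R ⧸ m) _) θm fun _ _ => Commute.all _ _
  let G := Algebra.TensorProduct.map (AlgHom.id (R ⧸ m) (R ⧸ m)) g
  have hΦG : Function.Injective (Φ.comp G) :=
    (algebraicIndependent_iff_injective_lift_comp_map g θm).mp hind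
  have hdom : IsDomain ((R ⧸ m) ⊗[k] B) := h.isDomain_tensorProduct
  refine ⟨R ⧸ m, inferInstance, inferInstance, hfin, n, Φ, ?_⟩
  have hG := AlgHom.IsIntegral.tensorProduct_map_id (C := R ⧸ m) g hgint
  exact hG.injective_of_injective_comp Φ.toRingHom hΦG

theorem mainTheorem6 (k : Type u) [Field k] (B : Type v) [CommRing B] [IsDomain B]
    [Algebra k B] [Algebra.FiniteType k B]
    (hPE : ∃ (K : Type w) (_ : Field K) (_ : Algebra k K), MemPE k B K) :
    (∃ (k' : Type u) (_ : Field k') (_ : Algebra k k'), Module.Finite k k' ∧ MemPE k B k') ∧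
    (∀ (kbar : Type x) [Field kbar] [Algebra k kbar] [IsAlgClosure k kbar], MemPE k B kbar) := by
  obtain ⟨K, _, _, hK⟩ := hPE
  obtain ⟨F, _, _, hfin, hF⟩ := hK.exists_finite
  refine ⟨?_, fun kbar _ _ _ => ?_⟩
  · let j : F →ₐ[k] AlgebraicClosure k := IsAlgClosed.lift
    exact ⟨j.fieldRange, inferInstance, inferInstance,
      Module.Finite.equiv (AlgEquiv.ofInjectiveField j).toLinearEquiv,
      hF.mono (AlgEquiv.ofInjectiveField j).toAlgHom⟩
  · have : IsAlgClosed kbar := IsAlgClosure.isAlgClosed k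
    exact hF.mono (IsAlgClosed.lift : F →ₐ[k] kbar)
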